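/- **Disjoint Multicast Theorem (ADT networks).** An ADT network $G$ has a finite set $\mathcal V$ of supernodes; each $V\in\mathcal V$ has a finite set $I(V)$ of input ports and a finite set $O(V)$ of output ports, and $\mathcal E$ is a set of edges $(e,e')$ from output ports $e$ to input ports $e'$. Assume that $G$ is acyclic, i.e. the directed graph on $\mathcal V$ in which $V_1\to V_2$ whenever some edge goes from $O(V_1)$ to $I(V_2)$ has no directed cycle. Fix a finite field $\mathbb F_q$, a source $S\in\mathcal V$ with processes $X(S,1),\dots,X(S,\mu)$, a finite set $\mathcal T\subseteq\mathcal V\setminus\{S\}$ of destinations, and for each $T\in\mathcal T$ a set $\mathcal X(S,T)\subseteq\{X(S,1),\dots,X(S,\mu)\}$; assume that $\mathcal X(S,T)\cap\mathcal X(S,T')=\emptyset$ for all distinct $T,T'\in\mathcal T$. Given coefficients $\alpha_{(i,e)},\beta_{(e',e)},\epsilon_{(e',(T,k))}\in\mathbb F_q$, the symbols $Y$ at the ports are determined by $$Y(e')=\sum_{(e,e')\in\mathcal E}Y(e)\quad(e'\in I(V)),\qquad Y(e)=\sum_{e'\in I(V)}\beta_{(e',e)}Y(e')+[V=S]\sum_{i=1}^{\mu}\alpha_{(i,e)}X(S,i)\quad(e\in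 O(V)),$$ and a destination $T$ forms $Z(T,k)=\sum_{e'\in I(T)}\epsilon_{(e',(T,k))}Y(e')$. The problem $(G,\{(S,T,\mathcal X(S,T)):T\in\mathcal T\})$ is *solvable* over $\mathbb F_q$ if the coefficients can be chosen such that, for all values of the source processes in $\mathbb F_q$, $Z(T,k)=X(S,k)$ for every $T\in\mathcal T$ and every $X(S,k)\in\mathcal X(S,T)$. For $\mathcal T'\subseteq\mathcal T$ let $$\mathrm{mincut}(S,\mathcal T')=\min\{\operatorname{rank}_{\mathbb F_q}(G_\Omega):\ \Omega\subseteq\mathcal V,\ S\in\Omega,\ \Omega\cap\mathcal T'=\emptyset\},$$ where $G_\Omega$ is the $0$-$1$ incidence matrix of the edges from output ports of supernodes in $\Omega$ (rows) to input ports of supernodes not in $\Omega$ (columns). Then the problem is solvable over $\mathbb F_q$ if and only if $$\mathrm{mincut}(S,\mathcal T')\ \ge\ \sum_{T\in\mathcal T'}|\mathcal X(S,T)|\qquad\text{for every }\mathcal T'\subseteq\mathcal T.$$ -/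

import Mathlib

/-- A deterministic (ADT) wireless network with supernode set `V`, input ports `In` and
output ports `Out`.  The input ports of a supernode `v` are the ports `i` with `inNode i = v`, its
output ports are the ports `o` with `outNode o = v`, and `Edge o i` says that there is an edge
from the output port `o` to the input port `i`. -/
structure ADTNetwork (V In Out : Type*) where
  inNode : In → V
  outNode : Out → V
  Edge : Out → In → Prop

namespace ADTNetwork

variable {V In Out : Type*}

/-- Some edge goes from an output port of `u` to an input port of `v`. -/
def Link (N : ADTNetwork V In Out) (u v : V) : Prop :=
  ∃ o i, N.outNode o = u ∧ N.inNode i = v ∧ N.Edge o i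

/-- No directed cycle of supernodes.  As every input port of a supernode may feed every output port
of it, this is the same as having no directed cycle of ports. -/
def Acyclic (N : ADTNetwork V In Out) : Prop :=
  ∀ v, ¬ Relation.TransGen N.Link v v

open Classical in
/-- The incidence matrix `G_Ω` of the bipartite graph between the output ports of the supernodes in
`Ω` and the input ports of the supernodes outside `Ω`, with entries in `F`. -/
noncomputable def cutMatrix (N : ADTNetwork V In Out) (F : Type*) [Field F] (Ω : Set V) :
    Matrix {o : Out // N.outNode o ∈ Ω} {i : In // N.inNode i ∉ Ω} F :=
  Matrix.of fun o i => if N.Edge o.1 i.1 then 1 else 0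

open Classical in
/-- `mincut(S, T')`: the minimum of `rank G_Ω` over all `Ω` that contain `S` and no element of `T'`.
For `S ∉ T'` there is such an `Ω`, so that the infimum in `ℕ` is an attained minimum. -/
noncomputable def mincut [Fintype In] (N : ADTNetwork V In Out) (F : Type*) [Field F]
    (S : V) (T' : Finset V) : ℕ :=
  sInf {r : ℕ | ∃ Ω : Set V, S ∈ Ω ∧ (∀ t ∈ T', t ∉ Ω) ∧ r = (N.cutMatrix F Ω).rank}

/-- The coding coefficients of a linear code for a source with `m` processes: `α i e` of the source
process `i` at the output port `e`, `β e' e` from the input port `e'` to the output port `e`, and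
`ε e' t k` of the input port `e'` in the `k`-th decoded process of the supernode `t`.  Only
`α i e` with `e` at the source, `β e' e` with `e', e` at the same supernode, and `ε e' t k` with
`e'` at `t` are ever used. -/
structure Code (V In Out : Type*) (m : ℕ) (F : Type*) where
  α : Fin m → Out → F
  β : In → Out → F
  ε : In → V → Fin m → F

variable {m : ℕ} {F : Type*} [Field F]

open Classical in
/-- The symbols `yIn`, `yOut` at the ports are those carried by the network when the source `S`
emits `x` and the code `c` is used: an input port receives the sum of the symbols of all output
ports with an edge to it, an output port sends the prescribed linear combination of the symbols at
the input ports of its supernode, to which the source adds the prescribed linear combination of its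
own processes. -/
def IsTransmission [Fintype In] [Fintype Out] (N : ADTNetwork V In Out) (S : V)
    (c : Code V In Out m F) (x : Fin m → F) (yIn : In → F) (yOut : Out → F) : Prop :=
  (∀ e' : In, yIn e' = ∑ e : Out, if N.Edge e e' then yOut e else 0) ∧
  (∀ e : Out, yOut e =
    (∑ e' : In, if N.inNode e' = N.outNode e then c.β e' e * yIn e' else 0) +
      if N.outNode e = S then ∑ i : Fin m, c.α i e * x i else 0)

open Classical in
/-- The `k`-th process `Z(t, k)` that the supernode `t` forms from the symbols at its input ports. -/
noncomputable def decoded [Fintype In] (N : ADTNetwork V In Out) (c : Code V In Out m F)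
    (yIn : In → F) (t : V) (k : Fin m) : F :=
  ∑ e' : In, if N.inNode e' = t then c.ε e' t k * yIn e' else 0

/-- Solvability over `F` of the connections `(S, t, X t)`, `t ∈ T`: coding coefficients in `F` can
be chosen such that, whatever the source symbols `x` are, every destination `t` reproduces the
processes in `X t`.  In an acyclic network the port symbols are determined by `x` and the code. -/
def Solvable [Fintype In] [Fintype Out] (N : ADTNetwork V In Out) (F : Type*) [Field F] (S : V)
    (T : Finset V) (X : V → Finset (Fin m)) : Prop :=
  ∃ c : Code V In Out m F, ∀ x : Fin m → F, ∃ (yIn : In → F) (yOut : Out → F),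
    N.IsTransmission S c x yIn yOut ∧ ∀ t ∈ T, ∀ k ∈ X t, N.decoded c yIn t k = x k

end ADTNetwork

/-! Necessity is a cut argument. By acyclicity the symbols received outside a cut `Ω` depend only on
the vector crossing it, which takes at most `|F| ^ rank` values, whereas the destinations outside
`Ω` recover all their processes from them (`card_biUnion_le_rank_cutMatrix`).

Sufficiency is a matrix completion problem. Disjointness gives each requested process a single
destination, so the transmission and decoding equations form a square matrix. Its free entries, the
coding coefficients, fill one block per supernode, and these blocks have disjoint rows and disjoint
columns. An invertible completion yields a code (`solvable_of_det_systemMatrix_ne_zero`). Over an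
infinite field a completion reaches the minimum, over sets `W` of supernodes, of the rank obtained
when the rows of the blocks in `W` and the columns of the other blocks are made free
(`exists_le_rank_bordered_of_blocks`). The cut bounds make each of these ranks large enough
(`card_le_rank_bordered_systemMatrix`).

Finally, the determinant is affine in each entry, so a completion over the algebraic closure can be
replaced by one whose free entries are 0 or 1 (`exists_det_ne_zero_of_map`). This is why no field is
too small. -/

namespace Matrix

/-! ### Rank certificates and rank along a line of matrices. -/

section RankGenericity

variable {ρ κ K L : Type*} [Field K] [Field L]

/-- A certificate for a rank bound that survives field extension and turns into a polynomial
condition on the entries. -/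
theorem exists_mul_mul_eq_one_of_le_rank [Fintype ρ] [Fintype κ] (A : Matrix ρ κ K) {r : ℕ}
    (h : r ≤ A.rank) :
    ∃ (U : Matrix (Fin r) ρ K) (W : Matrix κ (Fin r) K), U * A * W = 1 := by
  classical
  obtain ⟨v, hv⟩ := exists_linearIndependent_of_le_finrank (R := K)
    (M := LinearMap.range A.mulVecLin) h
  have hw : ∀ j, ∃ w : κ → K, A.mulVecLin w = (v j : ρ → K) := fun j => (v j).2
  choose w hw using hw
  have hli : LinearIndependent K (fun j => (v j : ρ → K)) :=
    hv.map' (Submodule.subtype _) (Submodule.ker_subtype _)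
  set W : Matrix κ (Fin r) K := Matrix.of fun i j => w j i
  have hcol : (A * W).col = fun j => (v j : ρ → K) := by
    funext j
    rw [← hw j]
    rfl
  have hinj : LinearMap.ker (A * W).mulVecLin = ⊥ := by
    rw [ker_mulVecLin_eq_bot_iff]
    intro x hx
    exact (mulVec_injective_iff.2 (hcol ▸ hli)) (hx.trans (mulVec_zero _).symm)
  obtain ⟨g, hg⟩ := LinearMap.exists_leftInverse_of_injective _ hinj
  refine ⟨LinearMap.toMatrix' g, W, ?_⟩
  rw [Matrix.mul_assoc]
  apply Matrix.toLin'.injective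
  rw [Matrix.toLin'_mul, Matrix.toLin'_toMatrix', Matrix.toLin'_one]
  exact hg

theorem le_rank_of_det_mul_mul_ne_zero [Fintype ρ] [Fintype κ] (A : Matrix ρ κ K) {r : ℕ}
    (U : Matrix (Fin r) ρ K) (W : Matrix κ (Fin r) K) (h : (U * A * W).det ≠ 0) :
    r ≤ A.rank := by
  have h1 := rank_of_det_ne_zero h
  rw [Fintype.card_fin] at h1
  calc r = (U * A * W).rank := h1.symm
    _ ≤ (U * A).rank := rank_mul_le_left _ _
    _ ≤ A.rank := rank_mul_le_right _ _

theorem rank_le_rank_map [Fintype ρ] [Fintype κ] (A : Matrix ρ κ K) (f : K →+* L) :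
    A.rank ≤ (A.map f).rank := by
  obtain ⟨U, W, h⟩ := exists_mul_mul_eq_one_of_le_rank A le_rfl
  refine le_rank_of_det_mul_mul_ne_zero _ (U.map f) (W.map f) ?_
  rw [← Matrix.map_mul, ← Matrix.map_mul, h]
  simp

/-- With `U`, `W` certifying the rank at `t₀`, the determinant of `U * (A + t • B) * W` is a
polynomial in `t` that is nonzero at `t₀`. Every bad `t` is one of its roots. -/
theorem finite_setOf_rank_add_smul_lt [Fintype ρ] [Fintype κ] (A B : Matrix ρ κ K) {r : ℕ} (t₀ : K)
    (h : r ≤ (A + t₀ • B).rank) : {t : K | (A + t • B).rank < r}.Finite := by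
  classical
  obtain ⟨U, W, hUW⟩ := exists_mul_mul_eq_one_of_le_rank _ h
  set p : Polynomial K := det ((Polynomial.X : Polynomial K) • (U * B * W).map Polynomial.C
    + (U * A * W).map Polynomial.C)
  have hp : ∀ t, p.eval t = (U * (A + t • B) * W).det := by
    intro t
    rw [← Polynomial.coe_evalRingHom, RingHom.map_det]
    congr 1
    rw [Matrix.mul_add, Matrix.add_mul, Matrix.mul_smul, Matrix.smul_mul, add_comm]
    generalize U * A * W = A'
    generalize U * B * W = B'
    ext i j
    simp only [RingHom.mapMatrix_apply, map_apply, add_apply, smul_apply, smul_eq_mul,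
      Polynomial.coe_evalRingHom, Polynomial.eval_add, Polynomial.eval_mul, Polynomial.eval_X,
      Polynomial.eval_C]
  have hp0 : p ≠ 0 := by
    intro h0
    have := hp t₀
    rw [h0, hUW] at this
    simp at this
  refine (p.roots.toFinset.finite_toSet).subset ?_
  intro t ht
  by_contra hn
  have : p.eval t ≠ 0 := fun h0 => hn (by simpa [hp0] using h0)
  rw [hp] at this
  exact absurd (le_rank_of_det_mul_mul_ne_zero _ _ _ this) (not_le.2 ht)

/-- Pairing `(B + single i j 1) *ᵥ x = 0` with `u` leaves `u i * x j = 0`. So the new kernel lies in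
the old one, and it misses `w`. -/
theorem rank_lt_rank_add_single [Fintype ρ] [Fintype κ] [DecidableEq ρ] [DecidableEq κ]
    (B : Matrix ρ κ K) {u : ρ → K} {w : κ → K} (hu : u ᵥ* B = 0) (hw : B *ᵥ w = 0)
    {i : ρ} {j : κ} (hi : u i ≠ 0) (hj : w j ≠ 0) :
    B.rank < (B + single i j 1).rank := by
  have key : LinearMap.ker (B + single i j 1).mulVecLin < LinearMap.ker B.mulVecLin := by
    refine lt_of_le_of_ne ?_ ?_
    · intro x hx
      simp only [LinearMap.mem_ker, mulVecLin_apply] at hx ⊢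
      have h1 : u ⬝ᵥ ((B + single i j 1) *ᵥ x) = u i * x j := by
        rw [add_mulVec, dotProduct_add, dotProduct_mulVec, hu, zero_dotProduct, zero_add,
          single_mulVec]
        simp [Function.update_apply, dotProduct]
      rw [hx, dotProduct_zero] at h1
      have hxj : x j = 0 := by
        rcases mul_eq_zero.1 h1.symm with h | h
        · exact absurd h hi
        · exact h
      rw [add_mulVec, single_mulVec, hxj] at hx
      simpa using hx
    · intro heq
      have : w ∈ LinearMap.ker (B + single i j 1).mulVecLin := by
        rw [heq]; exact hw
      simp only [LinearMap.mem_ker, mulVecLin_apply, add_mulVec, hw, zero_add,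
        single_mulVec] at this
      exact hj (by simpa using congrFun this i)
  have h1 := Submodule.finrank_lt_finrank_of_lt key
  have h2 := LinearMap.finrank_range_add_finrank_ker B.mulVecLin
  have h3 := LinearMap.finrank_range_add_finrank_ker (B + single i j 1).mulVecLin
  unfold rank
  omega

end RankGenericity

/-! ### Reducing free entries to 0 and 1. -/

section ZeroOne

variable {ι F K : Type*} [Field F] [Field K] [Fintype ι] [DecidableEq ι]

/-- The determinant is affine in a single entry; if it vanished at both 0 and 1 it would vanish
identically. -/
theorem exists_update_zero_or_one_det_ne_zero (M : Matrix ι ι K) (hM : M.det ≠ 0) (i j : ι) :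
    ∃ M' : Matrix ι ι K, M'.det ≠ 0 ∧ (M' i j = 0 ∨ M' i j = 1) ∧
      ∀ i' j', (i', j') ≠ (i, j) → M' i' j' = M i' j' := by
  have hdet : ∀ c : K, (M.updateRow i (M i + c • Pi.single j 1)).det =
      M.det + c * (M.updateRow i (Pi.single j 1)).det := by
    intro c
    rw [det_updateRow_add, det_updateRow_smul, updateRow_eq_self]
  have hval : ∀ c : K, (M.updateRow i (M i + c • Pi.single j 1)) i j = M i j + c := by
    intro c; simp
  have hoff : ∀ (c : K) i' j', (i', j') ≠ (i, j) →
      (M.updateRow i (M i + c • Pi.single j 1)) i' j' = M i' j' := by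
    intro c i' j' h
    by_cases hi : i' = i
    · subst hi
      have hj : j' ≠ j := fun h' => h (by rw [h'])
      simp [hj]
    · simp [updateRow_ne hi]
  by_cases h0 : (M.updateRow i (M i + (-M i j) • Pi.single j 1)).det = 0
  · refine ⟨_, ?_, Or.inr ((hval (1 - M i j)).trans (by ring)), hoff _⟩
    intro h1
    rw [hdet] at h0 h1
    have h2 : (M.updateRow i (Pi.single j 1)).det = 0 := by linear_combination h1 - h0
    rw [h2, mul_zero, add_zero] at h1
    exact hM h1
  · exact ⟨_, h0, Or.inl ((hval _).trans (by ring)), hoff _⟩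

theorem exists_zero_or_one_det_ne_zero (s : Finset (ι × ι)) (M : Matrix ι ι K) (hM : M.det ≠ 0) :
    ∃ M' : Matrix ι ι K, M'.det ≠ 0 ∧ (∀ i j, (i, j) ∈ s → M' i j = 0 ∨ M' i j = 1) ∧
      ∀ i j, (i, j) ∉ s → M' i j = M i j := by
  classical
  induction s using Finset.induction_on with
  | empty => exact ⟨M, hM, by simp, by simp⟩
  | insert a s _ ih =>
    obtain ⟨M₁, h1, h2, h3⟩ := ih
    obtain ⟨M₂, h4, h5, h6⟩ := exists_update_zero_or_one_det_ne_zero M₁ h1 a.1 a.2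
    refine ⟨M₂, h4, ?_, ?_⟩
    · intro i j hij
      by_cases h : (i, j) = a
      · subst h; exact h5
      · rw [h6 i j h]
        exact h2 i j ((Finset.mem_insert.1 hij).resolve_left h)
    · intro i j hij
      rw [Finset.mem_insert, not_or] at hij
      rw [h6 i j hij.1, h3 i j hij.2]

theorem exists_det_ne_zero_of_map (f : F →+* K) (P : ι → ι → Prop) (M₀ : Matrix ι ι F)
    (M : Matrix ι ι K) (hM : M.det ≠ 0) (hoff : ∀ i j, ¬ P i j → M i j = f (M₀ i j)) :
    ∃ M' : Matrix ι ι F, M'.det ≠ 0 ∧ ∀ i j, ¬ P i j → M' i j = M₀ i j := by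
  classical
  obtain ⟨M₁, h1, h2, h3⟩ :=
    exists_zero_or_one_det_ne_zero (Finset.univ.filter fun a : ι × ι => P a.1 a.2) M hM
  simp only [Finset.mem_filter, Finset.mem_univ, true_and] at h2 h3
  refine ⟨Matrix.of fun i j => if P i j then (if M₁ i j = 0 then 0 else 1) else M₀ i j, ?_, ?_⟩
  · intro h0
    apply h1
    have := congrArg f h0
    rw [RingHom.map_det, map_zero] at this
    convert this using 2
    ext i j
    by_cases hP : P i j
    · rcases h2 i j hP with h | h <;> simp [hP, h]
    · simp [hP, h3 i j hP, hoff i j hP]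
  · intro i j hP
    simp [hP]

end ZeroOne

end Matrix

namespace Matrix

/-! ### Completing a block matrix to maximal rank. -/

section Bordered

variable {ρ κ ν K : Type*} [Field K]

open Classical in
/-- The matrix `M` bordered by the unit columns of the rows in `p` and the unit rows of the
columns in `q`. -/
noncomputable def bordered (M : Matrix ρ κ K) (p : Set ρ) (q : Set κ) :
    Matrix (ρ ⊕ κ) (κ ⊕ ρ) K :=
  fromBlocks M (diagonal fun i => if i ∈ p then 1 else 0)
    (diagonal fun j => if j ∈ q then 1 else 0) 0

theorem transpose_bordered (M : Matrix ρ κ K) (p : Set ρ) (q : Set κ) :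
    (M.bordered p q)ᵀ = Mᵀ.bordered q p := by
  simp [bordered, fromBlocks_transpose]

theorem bordered_add (M E : Matrix ρ κ K) (p : Set ρ) (q : Set κ) :
    (M + E).bordered p q = M.bordered p q + fromBlocks E 0 0 0 := by
  simp [bordered, fromBlocks_add]

theorem bordered_add_smul (M E : Matrix ρ κ K) (t : K) (p : Set ρ) (q : Set κ) :
    (M + t • E).bordered p q = M.bordered p q + t • fromBlocks E 0 0 0 := by
  rw [bordered_add, fromBlocks_smul]
  simp

theorem bordered_add_single [DecidableEq ρ] [DecidableEq κ] (M : Matrix ρ κ K) (i : ρ) (j : κ)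
    (p : Set ρ) (q : Set κ) :
    (M + single i j 1).bordered p q = M.bordered p q + single (Sum.inl i) (Sum.inl j) 1 := by
  rw [bordered_add]
  congr 1
  ext (a | a) (b | b) <;> simp [single_apply]

theorem rank_eq_of_mulVec_eq_zero_iff {ρ' : Type*} [Fintype κ] (A : Matrix ρ κ K)
    (B : Matrix ρ' κ K) (h : ∀ x, A *ᵥ x = 0 ↔ B *ᵥ x = 0) : A.rank = B.rank := by
  have hker : LinearMap.ker A.mulVecLin = LinearMap.ker B.mulVecLin := by
    ext x; exact h x
  have h1 := LinearMap.finrank_range_add_finrank_ker A.mulVecLin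
  have h2 := LinearMap.finrank_range_add_finrank_ker B.mulVecLin
  rw [hker] at h1
  unfold rank
  omega

variable [Fintype ρ] [Fintype κ]

/-- Rows in `p` acquire a slack variable and columns in `q` are forced to zero. Hence the rank is
`|p| + |q|` plus the rank of `M` without these rows and columns. -/
theorem bordered_mulVec_eq_zero_iff (M : Matrix ρ κ K) (p : Set ρ) (q : Set κ)
    (x : κ ⊕ ρ → K) :
    M.bordered p q *ᵥ x = 0 ↔
      (∀ i, (∑ j, M i j * x (Sum.inl j)) + p.indicator (fun i => x (Sum.inr i)) i = 0) ∧
        ∀ j ∈ q, x (Sum.inl j) = 0 := by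
  classical
  rw [funext_iff, Sum.forall]
  refine and_congr (forall_congr' fun i => ?_) (forall_congr' fun j => ?_)
  · simp [bordered, mulVec, dotProduct, diagonal_apply, Set.indicator_apply]
  · simp [bordered, mulVec, dotProduct, diagonal_apply]

/-- If every kernel vector vanished on `J`, bordering `J` and changing its columns would leave the
kernel, hence the rank, unchanged. -/
theorem exists_mulVec_eq_zero_of_rank_bordered_lt (M N : Matrix ρ κ K) (p : Set ρ) (q J : Set κ)
    (hMN : ∀ i j, j ∉ J → N i j = M i j)
    (h : (N.bordered p q).rank < (M.bordered p (q ∪ J)).rank) :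
    ∃ x, N.bordered p q *ᵥ x = 0 ∧ ∃ j ∈ J, x (Sum.inl j) ≠ 0 := by
  by_contra! hcon
  refine h.ne (rank_eq_of_mulVec_eq_zero_iff _ _ fun x => ?_)
  have hsum : ∀ i, (∀ j ∈ J, x (Sum.inl j) = 0) →
      ∑ j, N i j * x (Sum.inl j) = ∑ j, M i j * x (Sum.inl j) := by
    intro i hx
    refine Finset.sum_congr rfl fun j _ => ?_
    by_cases hj : j ∈ J
    · rw [hx j hj, mul_zero, mul_zero]
    · rw [hMN i j hj]
  constructor
  · intro hx
    have hJ := hcon x hx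
    rw [bordered_mulVec_eq_zero_iff] at hx ⊢
    refine ⟨fun i => ?_, ?_⟩
    · rw [← hsum i hJ]; exact hx.1 i
    · rintro j (hj | hj)
      exacts [hx.2 j hj, hJ j hj]
  · intro hx
    rw [bordered_mulVec_eq_zero_iff] at hx ⊢
    refine ⟨fun i => ?_, fun j hj => hx.2 j (Or.inl hj)⟩
    rw [hsum i fun j hj => hx.2 j (Or.inr hj)]
    exact hx.1 i

theorem rank_bordered_transpose (M : Matrix ρ κ K) (p : Set ρ) (q : Set κ) :
    (Mᵀ.bordered q p).rank = (M.bordered p q).rank := by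
  rw [← transpose_bordered, rank_transpose]

/-- The rank of a bordered matrix can be raised, by changing the entries in one block, up to the
smaller of the two ranks with the rows or the columns of the block bordered. -/
theorem exists_le_rank_bordered_of_block (M : Matrix ρ κ K) (I p : Set ρ) (J q : Set κ) (r : ℕ)
    (hI : r ≤ (M.bordered (p ∪ I) q).rank) (hJ : r ≤ (M.bordered p (q ∪ J)).rank) :
    ∃ N : Matrix ρ κ K, (∀ i j, ¬ (i ∈ I ∧ j ∈ J) → N i j = M i j) ∧
      r ≤ (N.bordered p q).rank := by
  classical
  suffices ∀ k ≤ r, ∃ N : Matrix ρ κ K, (∀ i j, ¬ (i ∈ I ∧ j ∈ J) → N i j = M i j) ∧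
      k ≤ (N.bordered p q).rank from this r le_rfl
  intro k
  induction k with
  | zero => exact fun _ => ⟨M, fun _ _ _ => rfl, Nat.zero_le _⟩
  | succ k ih =>
    intro hk
    obtain ⟨N, hN, hkN⟩ := ih (by omega)
    by_cases hlt : k + 1 ≤ (N.bordered p q).rank
    · exact ⟨N, hN, hlt⟩
    -- While the rank is below both bounds, some right kernel vector is nonzero at a column of `J`
    -- and some left one at a row of `I`. A unit entry at their crossing raises the rank.
    obtain ⟨w, hw, j, hj, hwj⟩ := exists_mulVec_eq_zero_of_rank_bordered_lt M N p q J
      (fun i j hj => hN i j fun h => hj h.2) (by omega)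
    obtain ⟨u, hu, i, hi, hui⟩ := exists_mulVec_eq_zero_of_rank_bordered_lt Mᵀ Nᵀ q p I
      (fun j i hi => hN i j fun h => hi h.1)
      (by rw [rank_bordered_transpose, rank_bordered_transpose]; omega)
    rw [← transpose_bordered, mulVec_transpose] at hu
    have hrank := rank_lt_rank_add_single (N.bordered p q) hu hw hui hwj
    rw [← bordered_add_single] at hrank
    refine ⟨N + single i j 1, fun i' j' h => ?_, by omega⟩
    rw [add_apply, hN i' j' h, single_apply, if_neg, add_zero]
    rintro ⟨rfl, rfl⟩
    exact h ⟨hi, hj⟩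

/-- Completions good for different borderings are merged on the line joining them, where each
bordering excludes only finitely many points. -/
theorem exists_forall_le_rank_bordered [Infinite K] {σ : Type*} (s : Finset σ) (M : Matrix ρ κ K)
    (P : ρ → κ → Prop) (p : σ → Set ρ) (q : σ → Set κ) (r : ℕ)
    (h : ∀ a ∈ s, ∃ N : Matrix ρ κ K, (∀ i j, ¬ P i j → N i j = M i j) ∧
      r ≤ (N.bordered (p a) (q a)).rank) :
    ∃ N : Matrix ρ κ K, (∀ i j, ¬ P i j → N i j = M i j) ∧
      ∀ a ∈ s, r ≤ (N.bordered (p a) (q a)).rank := by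
  classical
  induction s using Finset.induction_on with
  | empty => exact ⟨M, fun _ _ _ => rfl, by simp⟩
  | insert a s _ ih =>
    obtain ⟨N₁, h1, h2⟩ := ih fun b hb => h b (Finset.mem_insert_of_mem hb)
    obtain ⟨N₂, h3, h4⟩ := h a (Finset.mem_insert_self _ _)
    have hfin : ∀ b ∈ insert a s,
        {t : K | ((N₁ + t • (N₂ - N₁)).bordered (p b) (q b)).rank < r}.Finite := by
      intro b hb
      simp only [bordered_add_smul]
      -- The line passes through `N₂` at `t = 1` and through `N₁` at `t = 0`.
      rcases Finset.mem_insert.1 hb with rfl | hb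
      · refine finite_setOf_rank_add_smul_lt _ _ 1 ?_
        rw [← bordered_add_smul]
        simpa using h4
      · refine finite_setOf_rank_add_smul_lt _ _ 0 ?_
        simpa using h2 b hb
    obtain ⟨t, ht⟩ := (Set.Finite.biUnion (insert a s).finite_toSet hfin).exists_notMem
    refine ⟨N₁ + t • (N₂ - N₁), fun i j hij => ?_, fun b hb => ?_⟩
    · simp [h1 i j hij, h3 i j hij]
    · by_contra hlt
      exact ht (Set.mem_biUnion hb (not_le.1 hlt))

/-- Over an infinite field, the entries in blocks with pairwise disjoint rows and pairwise disjoint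
columns (row `i` belongs to the block `a i`, column `j` to `b j`) can be chosen such that the rank
is the minimum over all ways to border each block by its rows or by its columns. -/
theorem exists_le_rank_bordered_of_blocks [Infinite K] (a : ρ → Option ν)
    (b : κ → Option ν) (s : Finset ν) (r : ℕ) (M : Matrix ρ κ K)
    (h : ∀ W ⊆ s, r ≤ (M.bordered {i | ∃ v ∈ W, a i = some v}
      {j | ∃ v ∈ s, v ∉ W ∧ b j = some v}).rank) :
    ∃ N : Matrix ρ κ K, (∀ i j, ¬ (∃ v, a i = some v ∧ b j = some v) → N i j = M i j) ∧
      r ≤ (N.bordered ∅ ∅).rank := by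
  classical
  induction s using Finset.induction_on generalizing M with
  | empty => exact ⟨M, fun _ _ _ => rfl, by simpa using h ∅ le_rfl⟩
  | insert v s hv ih =>
    -- One filling of block `v` must serve every `W ⊆ s` at once, since the induction hypothesis for
    -- the other blocks needs all these bounds.
    obtain ⟨N, h1, h2⟩ := exists_forall_le_rank_bordered s.powerset M
      (fun i j => a i = some v ∧ b j = some v) (fun W => {i | ∃ v ∈ W, a i = some v})
      (fun W => {j | ∃ v ∈ s, v ∉ W ∧ b j = some v}) r (by
        intro W hW
        rw [Finset.mem_powerset] at hW
        have hvW : v ∉ W := fun h => hv (hW h)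
        refine exists_le_rank_bordered_of_block M {i | a i = some v} _ {j | b j = some v} _ r ?_ ?_
        · convert h (insert v W) (Finset.insert_subset_insert v hW) using 3
          · ext i
            simp only [Set.mem_union, Set.mem_ofPred_eq, Finset.exists_mem_insert]
            exact or_comm
          · ext j
            simp only [Set.mem_ofPred_eq, Finset.mem_insert]
            constructor
            · rintro ⟨u, hu, huW, hju⟩
              refine ⟨u, Or.inr hu, ?_, hju⟩
              rintro (rfl | h)
              exacts [hv hu, huW h]
            · rintro ⟨u, hu, huW, hju⟩
              rw [not_or] at huW
              exact ⟨u, hu.resolve_left huW.1, huW.2, hju⟩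
        · convert h W (hW.trans (Finset.subset_insert v s)) using 3
          ext j
          simp only [Set.mem_union, Set.mem_ofPred_eq, Finset.exists_mem_insert, hvW,
            not_false_eq_true, true_and]
          exact or_comm)
    obtain ⟨N', h3, h4⟩ := ih N fun W hW => h2 W (Finset.mem_powerset.2 hW)
    exact ⟨N', fun i j hij => (h3 i j hij).trans (h1 i j fun h => hij ⟨v, h⟩), h4⟩

theorem rank_bordered_empty (M : Matrix ρ κ K) : (M.bordered ∅ ∅).rank ≤ M.rank := by
  classical
  have h : M.bordered ∅ ∅ = (fromRows 1 0 : Matrix (ρ ⊕ κ) ρ K) * M *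
      (fromCols 1 0 : Matrix κ (κ ⊕ ρ) K) := by
    rw [fromRows_mul, fromRows_mul_fromCols]
    simp [bordered]
  rw [h]
  exact (rank_mul_le_left _ _).trans (rank_mul_le_right _ _)

end Bordered

end Matrix

namespace ADTNetwork

/-! ### Necessity of the cut bounds. -/

section Converse

variable {V In Out : Type*} {m : ℕ} {F : Type*} [Field F] {N : ADTNetwork V In Out}

theorem Acyclic.wellFounded [Finite V] (hN : N.Acyclic) :
    WellFounded (Relation.TransGen N.Link) :=
  have : Std.Irrefl (Relation.TransGen N.Link) := ⟨hN⟩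
  Finite.wellFounded_of_trans_of_irrefl _

variable [Fintype Out]

theorem cutMatrix_transpose_mulVec_apply (Ω : Set V) (y : Out → F)
    (i : {i : In // N.inNode i ∉ Ω}) [Fintype {o : Out // N.outNode o ∈ Ω}]
    [∀ o, Decidable (N.outNode o ∈ Ω ∧ N.Edge o i.1)] :
    ((N.cutMatrix F Ω).transpose.mulVec fun o => y o.1) i =
      ∑ o, if N.outNode o ∈ Ω ∧ N.Edge o i.1 then y o else 0 := by
  classical
  simp only [Matrix.mulVec, dotProduct, Matrix.transpose_apply, cutMatrix, Matrix.of_apply,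
    ite_mul, one_mul, zero_mul]
  rw [← Finset.sum_subtype (Finset.univ.filter fun o => N.outNode o ∈ Ω) (by simp)
    (fun o => if N.Edge o i.1 then y o else 0), Finset.sum_filter]
  refine Finset.sum_congr rfl fun o _ => ?_
  by_cases h : N.outNode o ∈ Ω <;> simp [h]

variable [Fintype In]

/-- In an acyclic network, the symbols at the input ports outside a set containing the source are
determined by the symbols sent across the cut. -/
theorem IsTransmission.yIn_eq_of_cut_eq [Finite V] (hN : N.Acyclic) {S : V}
    {c : Code V In Out m F} {x x' : Fin m → F} {yIn yIn' : In → F} {yOut yOut' : Out → F}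
    (h : N.IsTransmission S c x yIn yOut) (h' : N.IsTransmission S c x' yIn' yOut')
    {Ω : Set V} [Fintype {o : Out // N.outNode o ∈ Ω}] (hS : S ∈ Ω)
    (hcut : ((N.cutMatrix F Ω).transpose.mulVec fun o => yOut o.1) =
      (N.cutMatrix F Ω).transpose.mulVec fun o => yOut' o.1)
    (i : In) (hi : N.inNode i ∉ Ω) : yIn i = yIn' i := by
  classical
  generalize hv : N.inNode i = v at hi
  induction v using hN.wellFounded.induction generalizing i with
  | _ v ih =>
    have hsplit : ∀ y : Out → F, (∑ o, if N.Edge o i then y o else 0) =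
        (∑ o, if N.outNode o ∈ Ω ∧ N.Edge o i then y o else 0) +
          ∑ o, if N.outNode o ∉ Ω ∧ N.Edge o i then y o else 0 := by
      intro y
      rw [← Finset.sum_add_distrib]
      refine Finset.sum_congr rfl fun o _ => ?_
      by_cases h1 : N.outNode o ∈ Ω <;> simp [h1]
    rw [h.1 i, h'.1 i, hsplit, hsplit]
    congr 1
    · have := congrFun hcut ⟨i, hv ▸ hi⟩
      rwa [cutMatrix_transpose_mulVec_apply, cutMatrix_transpose_mulVec_apply] at this
    · refine Finset.sum_congr rfl fun o _ => ?_
      by_cases ho : N.outNode o ∉ Ω ∧ N.Edge o i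
      · rw [if_pos ho, if_pos ho, h.2 o, h'.2 o]
        have hne : N.outNode o ≠ S := fun h => ho.1 (h ▸ hS)
        rw [if_neg hne, if_neg hne]
        congr 1
        refine Finset.sum_congr rfl fun e _ => ?_
        by_cases he : N.inNode e = N.outNode o
        · rw [if_pos he, if_pos he, ih _ (Relation.TransGen.single ⟨o, i, rfl, hv, ho.2⟩) e he ho.1]
        · rw [if_neg he, if_neg he]
      · rw [if_neg ho, if_neg ho]

/-- Counting suffices: the transmissions are merely chosen for each `x`, and need not depend
linearly on it. -/
theorem card_biUnion_le_rank_cutMatrix [Finite V] [Finite F] [DecidableEq (Fin m)]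
    (hN : N.Acyclic) {S : V} {T : Finset V} {X : V → Finset (Fin m)} (h : N.Solvable F S T X)
    {T' : Finset V} (hT' : T' ⊆ T) {Ω : Set V} (hS : S ∈ Ω) (hΩ : ∀ t ∈ T', t ∉ Ω)
    [Fintype {i : In // N.inNode i ∉ Ω}] :
    (T'.biUnion X).card ≤ (N.cutMatrix F Ω).rank := by
  classical
  obtain ⟨c, hc⟩ := h
  choose yIn yOut htr hdec using hc
  let ext : ({k // k ∈ T'.biUnion X} → F) → Fin m → F :=
    fun a k => if hk : k ∈ T'.biUnion X then a ⟨k, hk⟩ else 0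
  let φ : ({k // k ∈ T'.biUnion X} → F) → LinearMap.range (N.cutMatrix F Ω).transpose.mulVecLin :=
    fun a => ⟨_, LinearMap.mem_range_self _ fun o => yOut (ext a) o.1⟩
  have hφ : Function.Injective φ := by
    intro a b hab
    have hcut := congrArg Subtype.val hab
    have hin := IsTransmission.yIn_eq_of_cut_eq hN (htr (ext a)) (htr (ext b)) hS hcut
    funext ⟨k, hk⟩
    obtain ⟨t, ht, hkt⟩ := Finset.mem_biUnion.1 hk
    have h1 := hdec (ext a) t (hT' ht) k hkt
    have h2 := hdec (ext b) t (hT' ht) k hkt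
    have h3 : N.decoded c (yIn (ext a)) t k = N.decoded c (yIn (ext b)) t k := by
      refine Finset.sum_congr rfl fun e _ => ?_
      by_cases he : N.inNode e = t
      · rw [if_pos he, if_pos he, hin e (he ▸ hΩ t ht)]
      · rw [if_neg he, if_neg he]
    rw [h1, h2] at h3
    simpa only [ext, dif_pos hk] using h3
  have hcard := Nat.card_le_card_of_injective φ hφ
  have hrank : Module.finrank F (LinearMap.range (N.cutMatrix F Ω).transpose.mulVecLin) =
      (N.cutMatrix F Ω).rank := by
    rw [← Matrix.rank_transpose]; rfl
  rw [Module.natCard_eq_pow_finrank (K := F), Module.natCard_eq_pow_finrank (K := F)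
    (V := LinearMap.range _), hrank, Module.finrank_fintype_fun_eq_card, Fintype.card_coe] at hcard
  exact (Nat.pow_le_pow_iff_right Finite.one_lt_card).1 hcard

end Converse

end ADTNetwork

namespace ADTNetwork

/-! ### Sufficiency of the cut bounds. -/

section Direct

variable {V In Out : Type*} {m : ℕ} {F : Type*} [Field F]

open Classical in
/-- The transposed incidence matrix of all edges. -/
noncomputable def incMatrix (N : ADTNetwork V In Out) (F : Type*) [Field F] : Matrix In Out F :=
  Matrix.of fun i o => if N.Edge o i then 1 else 0

open Classical in
/-- The matrix of the equations of a transmission together with the decoding equations, for the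
zero code; `R` indexes the symbols that are sent and decoded. -/
noncomputable def systemMatrix (N : ADTNetwork V In Out) (F : Type*) [Field F] (R : Type*) :
    Matrix (In ⊕ (Out ⊕ R)) (In ⊕ (Out ⊕ R)) F :=
  Matrix.fromBlocks 1 (Matrix.fromCols (-N.incMatrix F) 0) 0 (Matrix.fromBlocks 1 0 0 0)

/-- The supernode whose coefficients occur in a row of the system matrix. -/
def rowNode (N : ADTNetwork V In Out) {R : Type*} (τ : R → V) : In ⊕ (Out ⊕ R) → Option V :=
  Sum.elim (fun _ => none) (Sum.elim (fun o => some (N.outNode o)) (fun k => some (τ k)))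

/-- The supernode whose coefficients occur in a column of the system matrix. -/
def colNode (N : ADTNetwork V In Out) (R : Type*) (S : V) : In ⊕ (Out ⊕ R) → Option V :=
  Sum.elim (fun i => some (N.inNode i)) (Sum.elim (fun _ => none) (fun _ => some S))

theorem systemMatrix_map (N : ADTNetwork V In Out) {K : Type*} [Field K] (f : F →+* K) (R : Type*)
    (i j : In ⊕ (Out ⊕ R)) : N.systemMatrix K R i j = f (N.systemMatrix F R i j) := by
  classical
  rcases i with i | i | i <;> rcases j with j | j | j <;>
    simp [systemMatrix, incMatrix, Matrix.one_apply, apply_ite f]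

theorem cutMatrix_map (N : ADTNetwork V In Out) {K : Type*} [Field K] (f : F →+* K) (Ω : Set V) :
    (N.cutMatrix F Ω).map f = N.cutMatrix K Ω := by
  ext i j
  simp [cutMatrix, apply_ite f]

variable [Fintype In] [Fintype Out] {R : Type*} [Fintype R]

open Classical in
-- The bordered matrix is square of twice the size, so it is enough that the kernel has at most half
-- the dimension of the whole space.
theorem card_le_rank_bordered_systemMatrix (N : ADTNetwork V In Out) (τ : R → V) (S : V)
    (W : Set V) (h : S ∈ W → Fintype.card {k : R // τ k ∉ W} ≤ (N.cutMatrix F W).rank) :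
    Fintype.card (In ⊕ (Out ⊕ R)) ≤ ((N.systemMatrix F R).bordered
      {i | ∃ v ∈ W, N.rowNode τ i = some v} {j | ∃ v, v ∉ W ∧ N.colNode R S j = some v}).rank := by
  set B := (N.systemMatrix F R).bordered
      {i | ∃ v ∈ W, N.rowNode τ i = some v} {j | ∃ v, v ∉ W ∧ N.colNode R S j = some v} with hB
  -- The transposed cut matrix padded with zeros, so that it acts on the symbols of all output
  -- ports.
  let C : Matrix In Out F :=
    Matrix.of fun i o => if N.outNode o ∈ W ∧ N.inNode i ∉ W ∧ N.Edge o i then 1 else 0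
  have hC : (N.cutMatrix F W).rank ≤ C.rank := by
    rw [← Matrix.rank_transpose C]
    have : N.cutMatrix F W = C.transpose.submatrix Subtype.val Subtype.val := by
      ext o i
      simp [C, cutMatrix, o.2, i.2]
    rw [this]
    exact Matrix.rank_submatrix_le _ _ _
  have hker : ∀ x : (In ⊕ (Out ⊕ R)) ⊕ (In ⊕ (Out ⊕ R)) → F, B.mulVec x = 0 →
      (∀ i, x (.inl (.inl i)) = ∑ o, N.incMatrix F i o * x (.inl (.inr (.inl o)))) ∧
      (∀ o, N.outNode o ∈ W → x (.inl (.inr (.inl o))) = - x (.inr (.inr (.inl o)))) ∧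
      (∀ o, N.outNode o ∉ W → x (.inl (.inr (.inl o))) = 0) ∧
      (∀ k, τ k ∈ W → x (.inr (.inr (.inr k))) = 0) ∧
      (∀ i, N.inNode i ∉ W → x (.inl (.inl i)) = 0) ∧
      (S ∉ W → ∀ k, x (.inl (.inr (.inr k))) = 0) := by
    intro x hx
    rw [hB, Matrix.bordered_mulVec_eq_zero_iff] at hx
    obtain ⟨h1, h2⟩ := hx
    simp only [Sum.forall] at h1 h2
    obtain ⟨h1, h3, h4⟩ := h1
    obtain ⟨h5, -, h6⟩ := h2
    simp [systemMatrix, rowNode, colNode, Set.indicator_apply, Matrix.one_apply] at h1 h3 h4 h5 h6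
    refine ⟨fun i => by linear_combination h1 i, fun o ho => ?_, fun o ho => ?_, h4, h5,
      fun hS k => h6 k hS⟩
    · have := h3 o
      rw [if_pos ho] at this
      linear_combination this
    · have := h3 o
      rwa [if_neg ho, add_zero] at this
  have hmem : ∀ x : LinearMap.ker B.mulVecLin,
      (LinearMap.funLeft F F (fun o : Out => Sum.inr (Sum.inr (Sum.inl o))) ∘ₗ
        (LinearMap.ker B.mulVecLin).subtype) x ∈ LinearMap.ker C.mulVecLin := by
    intro x
    obtain ⟨h1, h2, h3, -, h5, -⟩ := hker x.1 x.2
    rw [LinearMap.mem_ker]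
    funext i
    by_cases hi : N.inNode i ∈ W
    · simp [C, Matrix.mulVec, dotProduct, hi]
    · rw [Pi.zero_apply, ← neg_eq_zero, ← h5 i hi, h1 i]
      simp only [Matrix.mulVecLin_apply, Matrix.mulVec, dotProduct]
      rw [← Finset.sum_neg_distrib]
      refine Finset.sum_congr rfl fun o _ => ?_
      by_cases ho : N.outNode o ∈ W
      · rw [h2 o ho]
        simp [C, incMatrix, hi, ho, LinearMap.funLeft_apply]
      · rw [h3 o ho]
        simp [C, ho]
  -- These coordinates determine a kernel vector: the slacks of input rows, the slacks of output
  -- rows (constrained by `C`), the slacks of decoding rows outside `W`, and the sent symbols if `S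
  -- ∈ W`.
  let L : LinearMap.ker B.mulVecLin →ₗ[F]
      (In → F) × LinearMap.ker C.mulVecLin × ({k : R // τ k ∉ W} → F) × ({k : R // S ∈ W} → F) :=
    (LinearMap.funLeft F F (fun i : In => Sum.inr (Sum.inl i)) ∘ₗ
      (LinearMap.ker B.mulVecLin).subtype).prod <|
    (LinearMap.codRestrict _ _ hmem).prod <|
    (LinearMap.funLeft F F (fun k : {k : R // τ k ∉ W} => Sum.inr (Sum.inr (Sum.inr k.1))) ∘ₗ
      (LinearMap.ker B.mulVecLin).subtype).prod
    (LinearMap.funLeft F F (fun k : {k : R // S ∈ W} => Sum.inl (Sum.inr (Sum.inr k.1))) ∘ₗ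
      (LinearMap.ker B.mulVecLin).subtype)
  have hL : Function.Injective L := by
    rw [← LinearMap.ker_eq_bot, LinearMap.ker_eq_bot']
    intro x hx
    obtain ⟨h1, h2, h3, h4, h5, h6⟩ := hker x.1 x.2
    have e1 : ∀ i, x.1 (.inr (.inl i)) = 0 := fun i => congrFun (congrArg Prod.fst hx) i
    have e2 : ∀ o, x.1 (.inr (.inr (.inl o))) = 0 := fun o =>
      congrFun (congrArg (fun y => (y.2.1 : Out → F)) hx) o
    have e3 : ∀ k, τ k ∉ W → x.1 (.inr (.inr (.inr k))) = 0 := fun k hk =>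
      congrFun (congrArg (fun y => y.2.2.1) hx) ⟨k, hk⟩
    have e4 : S ∈ W → ∀ k, x.1 (.inl (.inr (.inr k))) = 0 := fun hS k =>
      congrFun (congrArg (fun y => y.2.2.2) hx) ⟨k, hS⟩
    have e5 : ∀ o, x.1 (.inl (.inr (.inl o))) = 0 := by
      intro o
      by_cases ho : N.outNode o ∈ W
      · rw [h2 o ho, e2, neg_zero]
      · exact h3 o ho
    apply Subtype.ext
    funext j
    rcases j with (i | o | k) | (i | o | k)
    · simp [h1, e5]
    · exact e5 o
    · by_cases hS : S ∈ W
      exacts [e4 hS k, h6 hS k]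
    · exact e1 i
    · exact e2 o
    · by_cases hk : τ k ∈ W
      exacts [h4 k hk, e3 k hk]
  have hdim := LinearMap.finrank_le_finrank_of_injective hL
  have hB' := LinearMap.finrank_range_add_finrank_ker B.mulVecLin
  have hC' := LinearMap.finrank_range_add_finrank_ker C.mulVecLin
  simp only [Module.finrank_prod, Module.finrank_fintype_fun_eq_card, Fintype.card_sum]
    at hdim hB' hC' ⊢
  have hle : Fintype.card {k : R // τ k ∉ W} ≤ Fintype.card R := Fintype.card_subtype_le _
  unfold Matrix.rank at hC h ⊢
  by_cases hS : S ∈ W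
  · have h1 := h hS
    have h2 : Fintype.card {k : R // S ∈ W} ≤ Fintype.card R := Fintype.card_subtype_le _
    omega
  · have h2 : Fintype.card {k : R // S ∈ W} = 0 := by
      rw [Fintype.card_eq_zero_iff]
      exact ⟨fun k => hS k.2⟩
    omega

theorem solvable_of_det_systemMatrix_ne_zero [DecidableEq In] [DecidableEq Out]
    (N : ADTNetwork V In Out) {S : V} {T : Finset V} {X : V → Finset (Fin m)} {P : Fin m → Prop}
    [Fintype {k // P k}] [DecidableEq {k // P k}] (τ : {k // P k} → V)
    (hτ : ∀ t ∈ T, ∀ k ∈ X t, ∃ h : P k, τ ⟨k, h⟩ = t) (hτS : ∀ k, τ k ≠ S)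
    (M : Matrix (In ⊕ (Out ⊕ {k // P k})) (In ⊕ (Out ⊕ {k // P k})) F) (hM : M.det ≠ 0)
    (hM₀ : ∀ i j, ¬ (∃ v, N.rowNode τ i = some v ∧ N.colNode _ S j = some v) →
      M i j = N.systemMatrix F _ i j) :
    N.Solvable F S T X := by
  classical
  let rhs : (Fin m → F) →ₗ[F] (In ⊕ (Out ⊕ {k // P k}) → F) :=
    { toFun := fun x => Sum.elim 0 (Sum.elim 0 fun k => x k.1)
      map_add' := fun x y => by ext (i | o | k) <;> simp
      map_smul' := fun a x => by ext (i | o | k) <;> simp }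
  -- The last components of `sol x` are symbols precoded from `x` so that decoding returns `x`
  -- itself; `enc` absorbs this precoding into the source coefficients.
  obtain ⟨sol, hsol⟩ : ∃ sol : (Fin m → F) →ₗ[F] (In ⊕ (Out ⊕ {k // P k}) → F),
      ∀ x, M.mulVec (sol x) = rhs x := by
    refine ⟨M⁻¹.mulVecLin ∘ₗ rhs, fun x => ?_⟩
    rw [LinearMap.comp_apply, Matrix.mulVecLin_apply, Matrix.mulVec_mulVec,
      Matrix.mul_nonsing_inv _ (isUnit_iff_ne_zero.2 hM), Matrix.one_mulVec]
  obtain ⟨enc, henc⟩ : ∃ enc : (Fin m → F) →ₗ[F] (Out → F), ∀ x o,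
      enc x o = -∑ k, M (.inr (.inl o)) (.inr (.inr k)) * sol x (.inr (.inr k)) :=
    ⟨-((M.submatrix (fun o => .inr (.inl o)) (fun k => .inr (.inr k))).mulVecLin ∘ₗ
      LinearMap.funLeft F F (fun k => .inr (.inr k)) ∘ₗ sol), fun x o => rfl⟩
  have hin : ∀ i j, M (.inl i) j = N.systemMatrix F _ (.inl i) j := fun i j =>
    hM₀ _ _ (by simp [rowNode])
  have hout : ∀ i o, M i (.inr (.inl o)) = N.systemMatrix F _ i (.inr (.inl o)) := fun i o =>
    hM₀ _ _ (by simp [colNode])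
  -- A decoding row and a sent-symbol column would share a block only at a destination equal to `S`.
  have hdd : ∀ k k', M (.inr (.inr k)) (.inr (.inr k')) = 0 := fun k k' =>
    (hM₀ _ _ (by simpa [rowNode, colNode] using fun h => hτS k h.symm)).trans (by simp [systemMatrix])
  have hβ : ∀ o i, N.inNode i ≠ N.outNode o → M (.inr (.inl o)) (.inl i) = 0 := fun o i h =>
    (hM₀ _ _ (by simpa [rowNode, colNode] using h)).trans (by simp [systemMatrix])
  have hα : ∀ o k, N.outNode o ≠ S → M (.inr (.inl o)) (.inr (.inr k)) = 0 := fun o k h =>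
    (hM₀ _ _ (by simpa [rowNode, colNode] using h.symm)).trans (by simp [systemMatrix])
  have hε : ∀ k i, N.inNode i ≠ τ k → M (.inr (.inr k)) (.inl i) = 0 := fun k i h =>
    (hM₀ _ _ (by simpa [rowNode, colNode] using h)).trans (by simp [systemMatrix])
  refine ⟨⟨fun k o => enc (Pi.single k 1) o, fun i o => -M (.inr (.inl o)) (.inl i),
    fun i _ k => if h : P k then M (.inr (.inr ⟨k, h⟩)) (.inl i) else 0⟩, fun x =>
    ⟨fun i => sol x (.inl i), fun o => sol x (.inr (.inl o)), ⟨fun i => ?_, fun o => ?_⟩, ?_⟩⟩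
  · have := congrFun (hsol x) (.inl i)
    simp [Matrix.mulVec, dotProduct, hin, systemMatrix, incMatrix, rhs, Matrix.one_apply] at this
    linear_combination this
  · have := congrFun (hsol x) (.inr (.inl o))
    simp [Matrix.mulVec, dotProduct, hout, systemMatrix, incMatrix, rhs, Matrix.one_apply] at this
    have hsum : ∑ k, enc (Pi.single k 1) o * x k = enc x o := by
      have hx : x = ∑ k, x k • (Pi.single k 1 : Fin m → F) := by
        funext j
        simp [Pi.single_apply]
      conv_rhs => rw [hx, map_sum, Finset.sum_apply]
      simp [mul_comm]
    have hβ' : (∑ e, if N.inNode e = N.outNode o then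
        -M (.inr (.inl o)) (.inl e) * sol x (.inl e) else 0) =
        -∑ e, M (.inr (.inl o)) (.inl e) * sol x (.inl e) := by
      rw [← Finset.sum_neg_distrib]
      refine Finset.sum_congr rfl fun e _ => ?_
      split_ifs with h
      · ring
      · rw [hβ o e h]; ring
    have hα' : (if N.outNode o = S then ∑ k, enc (Pi.single k 1) o * x k else 0) = enc x o := by
      split_ifs with h
      · exact hsum
      · rw [henc]
        simp [hα o _ h]
    change sol x (.inr (.inl o)) = (∑ e, if N.inNode e = N.outNode o then
      -M (.inr (.inl o)) (.inl e) * sol x (.inl e) else 0) +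
        if N.outNode o = S then ∑ k, enc (Pi.single k 1) o * x k else 0
    rw [hβ', hα', henc]
    linear_combination this
  · intro t ht k hk
    obtain ⟨hP, hτk⟩ := hτ t ht k hk
    have := congrFun (hsol x) (.inr (.inr ⟨k, hP⟩))
    simp [Matrix.mulVec, dotProduct, hout, hdd, systemMatrix, incMatrix, rhs] at this
    rw [← this]
    refine Finset.sum_congr rfl fun e _ => ?_
    split_ifs with h
    · simp [hP]
    · rw [hε _ e fun h' => h (h'.trans hτk), zero_mul]

open Classical in
/-- The cut bounds suffice for solvability; this direction needs neither the acyclicity of the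
network nor the finiteness of the field. -/
theorem solvable_of_sum_card_le_rank_cutMatrix [Finite V] (N : ADTNetwork V In Out) {S : V}
    {T : Finset V} {X : V → Finset (Fin m)} (hST : S ∉ T)
    (hX : ∀ t ∈ T, ∀ t' ∈ T, t ≠ t' → Disjoint (X t) (X t'))
    (h : ∀ T' ⊆ T, ∀ Ω : Set V, S ∈ Ω → (∀ t ∈ T', t ∉ Ω) →
      ∑ t ∈ T', (X t).card ≤ (N.cutMatrix F Ω).rank) :
    N.Solvable F S T X := by
  have := Fintype.ofFinite V
  let P : Fin m → Prop := fun k => ∃ t ∈ T, k ∈ X t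
  let τ : {k // P k} → V := fun k => k.2.choose
  have hτT : ∀ k, τ k ∈ T := fun k => k.2.choose_spec.1
  have hτX : ∀ k, k.1 ∈ X (τ k) := fun k => k.2.choose_spec.2
  let K := AlgebraicClosure F
  let f : F →+* K := algebraMap F K
  have hcut : ∀ W : Set V, S ∈ W →
      Fintype.card {k : {k // P k} // τ k ∉ W} ≤ (N.cutMatrix K W).rank := by
    intro W hS
    rw [← cutMatrix_map N f]
    refine le_trans ?_ (Matrix.rank_le_rank_map _ f)
    -- The bound is applied to exactly the destinations beyond the cut.
    refine le_trans ?_ (h (T.filter fun t => t ∉ W) (Finset.filter_subset _ _) W hS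
      fun t ht => (Finset.mem_filter.1 ht).2)
    refine le_trans ?_ Finset.card_biUnion_le
    rw [← Fintype.card_coe]
    refine Fintype.card_le_of_injective (fun k => ⟨k.1.1, Finset.mem_biUnion.2 ⟨τ k.1,
      Finset.mem_filter.2 ⟨hτT k.1, k.2⟩, hτX k.1⟩⟩) fun k k' hk => ?_
    simpa [Subtype.ext_iff] using hk
  obtain ⟨M, hM₀, hM⟩ := Matrix.exists_le_rank_bordered_of_blocks (N.rowNode τ)
    (N.colNode {k // P k} S) Finset.univ (Fintype.card (In ⊕ (Out ⊕ {k // P k})))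
    (N.systemMatrix K {k // P k}) (by
      intro W _
      simpa only [Finset.mem_univ, true_and, Finset.mem_coe] using
        N.card_le_rank_bordered_systemMatrix (F := K) τ S (W : Set V) (hcut W))
  have hdet : M.det ≠ 0 := by
    have hrank := hM.trans (Matrix.rank_bordered_empty M)
    have hli : LinearMap.range M.mulVecLin = ⊤ := by
      apply Submodule.eq_top_of_finrank_eq
      rw [Module.finrank_fintype_fun_eq_card]
      exact le_antisymm (Matrix.rank_le_card_height M) hrank
    have hsurj := LinearMap.range_eq_top.1 hli
    exact ((Matrix.isUnit_iff_isUnit_det _).1 (Matrix.mulVec_surjective_iff_isUnit.1 hsurj)).ne_zero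
  obtain ⟨M', hM', hM₀'⟩ := Matrix.exists_det_ne_zero_of_map f
    (fun i j => ∃ v, N.rowNode τ i = some v ∧ N.colNode {k // P k} S j = some v)
    (N.systemMatrix F {k // P k}) M hdet
    (fun i j hij => (hM₀ i j hij).trans (systemMatrix_map N f _ i j))
  refine N.solvable_of_det_systemMatrix_ne_zero τ (fun t ht k hk => ⟨⟨t, ht, hk⟩, ?_⟩)
    (fun k hk => hST (hk ▸ hτT k)) M' hM' hM₀'
  -- Disjointness makes the destination chosen by `τ` the only one requesting the process.
  by_contra hne
  exact Finset.disjoint_left.1 (hX _ (hτT ⟨k, t, ht, hk⟩) t ht hne) (hτX ⟨k, t, ht, hk⟩) hk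

end Direct

end ADTNetwork

theorem mainTheorem6 {V In Out : Type*} [Fintype V] [Fintype In] [Fintype Out]
    (N : ADTNetwork V In Out) (hN : N.Acyclic)
    (F : Type*) [Field F] [Finite F]
    (m : ℕ) (S : V) (T : Finset V) (hST : S ∉ T) (X : V → Finset (Fin m))
    (hX : ∀ t ∈ T, ∀ t' ∈ T, t ≠ t' → Disjoint (X t) (X t')) :
    N.Solvable F S T X ↔
      ∀ T' : Finset V, T' ⊆ T → ∑ t ∈ T', (X t).card ≤ N.mincut F S T' := by
  classical
  constructor
  · intro h T' hT'
    rw [← Finset.card_biUnion fun t ht t' ht' => hX t (hT' ht) t' (hT' ht')]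
    -- The cut `{S}` shows that the infimum is over a nonempty set.
    refine le_csInf ⟨_, {S}, rfl, fun t ht hS => hST (hS ▸ hT' ht), rfl⟩ ?_
    rintro r ⟨Ω, hS, hΩ, rfl⟩
    exact ADTNetwork.card_biUnion_le_rank_cutMatrix hN h hT' hS hΩ
  · intro h
    refine N.solvable_of_sum_card_le_rank_cutMatrix hST hX fun T' hT' Ω hS hΩ => ?_
    exact (h T' hT').trans (Nat.sInf_le ⟨Ω, hS, hΩ, rfl⟩)
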